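/- Let $\mathbb{F}$ be a field of prime characteristic $p$, let $L$ be a finite-dimensional Lie algebra over $\mathbb{F}$, and let $M$ be a finite-dimensional $L$-module with representation $\rho\colon L\to\mathfrak{gl}(M)$. Let $(\mathfrak{L},(\cdot)^{[p]},\iota)$ be a $p$-envelope of $L$, i.e. $\mathfrak{L}$ is a restricted Lie algebra with $p$-mapping $(\cdot)^{[p]}$ and $\iota\colon L\to\mathfrak{L}$ is an injective Lie algebra homomorphism such that $\mathfrak{L}$ is generated by $\iota(L)$ as a restricted Lie algebra. Assume that $k:=\dim_{\mathbb{F}}\mathfrak{L}/\iota(L)<\infty$. Let $(\hat L,(\cdot)^{p},\hat\iota)$ be the universal $p$-envelope of $L$ (the $p$-envelope such that every Lie algebra homomorphism from $L$ into a restricted Lie algebra factors through $\hat\iota$ by a unique restricted homomorphism), and let $\hat\rho\colon\hat L\to\mathfrak{gl}(M)$ be the restricted homomorphism with $\hat\rho\circ\hat\iota=\rho$. Let $\phi\colon\mathfrak{L}\to\hat L$ be any Lie algebra homomorphism with $\phi\circ\iota=\hat\iota$, and consider $M$ as an $\mathfrak{L}$-module by means of $\hat\rho\circ\phi$. Then,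 with $H^n$ denoting ordinary (Chevalley–Eilenberg) Lie algebra cohomology and $M^L=\{m\in M : x\cdot m=0 \text{ for all } x\in L\}$: 1. $H^0(\mathfrak{L},M)\cong H^0(L,M)$ as $\mathbb{F}$-vector spaces. 2. $\dim_{\mathbb{F}}H^1(\mathfrak{L},M)=\dim_{\mathbb{F}}H^1(L,M)+k\dim_{\mathbb{F}}M^L$. 3. $\dim_{\mathbb{F}}H^2(\mathfrak{L},M)=\dim_{\mathbb{F}}H^2(L,M)+k\dim_{\mathbb{F}}H^1(L,M)+\frac{k(k-1)}{2}\dim_{\mathbb{F}}M^L$. -/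

import Mathlib

set_option maxSynthPendingDepth 3

attribute [local instance 100] LieRing.ofAssociativeRing

/-! ### Low degree cohomology of Lie algebras

The Chevalley-Eilenberg complex `M → Hom(L, M) → Alt²(L, M) → …` in degrees `≤ 2`.  The cochains and
the differentials out of degrees one and two are those of Mathlib (`LieModule.Cohomology`).
-/

namespace LieCohomology

open LieModule.Cohomology

variable (F : Type*) [Field F] (L : Type*) [LieRing L] [LieAlgebra F L]
variable (M : Type*) [AddCommGroup M] [Module F M] [LieRingModule L M] [LieModule F L M]

/-- The differential from degree zero to degree one, `(d m)(x) = x · m`. -/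
def d₀₁ : M →ₗ[F] oneCochain F L M where
  toFun m :=
    { toFun x := ⁅x, m⁆
      map_add' _ _ := by simp
      map_smul' _ _ := by simp }
  map_add' _ _ := by ext; simp
  map_smul' _ _ := by ext; simp

/-- `H⁰(L, M)`, the kernel of the first differential. -/
abbrev H0 : Type _ := LinearMap.ker (d₀₁ F L M)

/-- The 1-cocycles: linear maps `f` with `x · f y - y · f x - f [x, y] = 0`. -/
def Z1 : Submodule F (oneCochain F L M) := LinearMap.ker (d₁₂ F L M)

/-- The 1-coboundaries. -/
def B1 : Submodule F (oneCochain F L M) := LinearMap.range (d₀₁ F L M)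

/-- `H¹(L, M) = Z¹(L, M) / B¹(L, M)`. -/
abbrev H1 : Type _ := Z1 F L M ⧸ (B1 F L M).submoduleOf (Z1 F L M)

/-- The 2-coboundaries `(x, y) ↦ x · f y - y · f x - f [x, y]`. -/
def B2 : Submodule F (twoCochain F L M) := LinearMap.range (d₁₂ F L M)

/-- `H²(L, M) = Z²(L, M) / B²(L, M)`. -/
abbrev H2 : Type _ := twoCocycle F L M ⧸ (B2 F L M).submoduleOf (twoCocycle F L M)

theorem B1_le_Z1 : B1 F L M ≤ Z1 F L M := by
  rintro _ ⟨m, rfl⟩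
  rw [Z1, LinearMap.mem_ker]
  ext x y
  simp [d₀₁]

theorem B2_le_twoCocycle : B2 F L M ≤ twoCocycle F L M := by
  rintro _ ⟨f, rfl⟩
  rw [twoCocycle, LinearMap.mem_ker]
  exact LinearMap.congr_fun (d₂₃_comp_d₁₂ F L M) f

end LieCohomology

/-! ### Restricted Lie algebras and `p`-envelopes -/

namespace RestrictedLie

/-- `adCoeff x y k n` is the coefficient of `Tⁿ` in `ad(T x + y)ᵏ (x)`, computed in `L ⊗ F[T]`. -/
def adCoeff {L : Type*} [LieRing L] (x y : L) : ℕ → ℕ → L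
  | 0, 0 => x
  | 0, _ + 1 => 0
  | k + 1, 0 => ⁅y, adCoeff x y k 0⁆
  | k + 1, n + 1 => ⁅x, adCoeff x y k n⁆ + ⁅y, adCoeff x y k (n + 1)⁆

/-- The Lie polynomials `sᵢ(x, y)`, `1 ≤ i ≤ p - 1`, of Jacobson's formula: `i sᵢ(x, y)` is the
coefficient of `Tⁱ⁻¹` in `ad(T x + y)ᵖ⁻¹ (x)`. -/
def jacobsonS (F : Type*) [Field F] (p : ℕ) {L : Type*} [LieRing L] [LieAlgebra F L]
    (i : ℕ) (x y : L) : L :=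
  (i : F)⁻¹ • adCoeff x y (p - 1) (i - 1)

/-- `pm` is a `p`-mapping on the Lie algebra `L`, that is, `(L, pm)` is a restricted Lie algebra. -/
structure IsPMap (F : Type*) [Field F] (p : ℕ) {L : Type*} [LieRing L] [LieAlgebra F L]
    (pm : L → L) : Prop where
  ad_pm : ∀ x : L, LieAlgebra.ad F L (pm x) = (LieAlgebra.ad F L x) ^ p
  pm_smul : ∀ (a : F) (x : L), pm (a • x) = a ^ p • pm x
  pm_add : ∀ x y : L,
    pm (x + y) = pm x + pm y + ∑ i ∈ Finset.Ico 1 p, jacobsonS F p i x y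

/-- A Lie algebra homomorphism is restricted if it commutes with the given `p`-mappings. -/
def IsRestrictedHom {F : Type*} [Field F] {L H : Type*} [LieRing L] [LieAlgebra F L]
    [LieRing H] [LieAlgebra F H] (pmL : L → L) (pmH : H → H) (g : L →ₗ⁅F⁆ H) : Prop :=
  ∀ x, g (pmL x) = pmH (g x)

/-- The restricted subalgebra `⟨S⟩ₚ` generated by a subset `S`: the smallest Lie subalgebra that
contains `S` and is closed under the `p`-mapping. -/
def pSpan (F : Type*) [Field F] {L : Type*} [LieRing L] [LieAlgebra F L]
    (pm : L → L) (S : Set L) : LieSubalgebra F L :=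
  sInf {K : LieSubalgebra F L | S ⊆ K ∧ ∀ x ∈ K, pm x ∈ K}

/-- `(E, pm, ι)` is a `p`-envelope of `L`. -/
structure IsPEnvelope (F : Type*) [Field F] (p : ℕ) {L E : Type*} [LieRing L] [LieAlgebra F L]
    [LieRing E] [LieAlgebra F E] (pm : E → E) (ι : L →ₗ⁅F⁆ E) : Prop where
  isPMap : IsPMap F p pm
  injective : Function.Injective ι
  pSpan_eq_top : pSpan F pm (Set.range ι) = ⊤

universe w

/-- `(E, pm, ι)` is a universal `p`-envelope of `L`: a `p`-envelope such that every homomorphism from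
`L` into a restricted Lie algebra factors through a unique restricted homomorphism from `E`. -/
structure IsUniversalPEnvelope (F : Type*) [Field F] (p : ℕ) {L E : Type*} [LieRing L]
    [LieAlgebra F L] [LieRing E] [LieAlgebra F E] (pm : E → E) (ι : L →ₗ⁅F⁆ E) : Prop
    extends IsPEnvelope F p pm ι where
  existsUnique_lift : ∀ (H : Type w) [LieRing H] [LieAlgebra F H] (pmH : H → H),
    IsPMap F p pmH → ∀ f : L →ₗ⁅F⁆ H,
      ∃! g : E →ₗ⁅F⁆ H, IsRestrictedHom pm pmH g ∧ g.comp ι = f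

end RestrictedLie

/-! All brackets of `E` lie in `ι(L)`, so every subspace between `ι(L)` and `E` is an ideal, and `E`
is reached from `ι(L)` by adjoining `k` elements one at a time. If `B = A ⊕ F t` with `A` an ideal,
an `n`-cocycle on `B` is a pair of an `n`-cocycle `f` on `A` and an `(n-1)`-cochain `g` with `d g =
θ_t f`, where `θ_t` is the action of `t` on cochains. If `t` acts trivially on the cohomology of
`A`, such a `g` always exists, so `dim Zⁿ(B) = dim Zⁿ(A) + dim Zⁿ⁻¹(A)`. Iteration gives binomial
coefficients, and rank-nullity converts dimensions of cocycles into those of cohomology.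

The crux is `IsPEnvelope.actsTrivially`: `E` acts trivially on the cohomology of each intermediate
`K`. By Cartan's formula `L` does, and trivial action survives linear combinations, brackets and
`p`-th powers (`ActsTrivially.pow`). Since `φ` need not be restricted, `pm e` need not act on `M` as
the `p`-th power of `e`. Therefore `e` is paired with some `u : U` built by the same operations, and
`(ad e, ρ u)` acts trivially. The discrepancy `u - φ e` centralizes `L` and is itself paired with a
central `e'` of `E`; subtracting the two pairs leaves `(ad e, ρ (φ e))`. -/

namespace LieCohomology

open LieModule.Cohomology Module

/-! ### Operators on cochains and their `p`-th powers -/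

section Operators

variable {F A M : Type*} [Field F] [AddCommGroup A] [Module F A] [AddCommGroup M] [Module F M]

/-- The operator `f ↦ β ∘ f - f ∘ α` on linear maps. -/
def theta (α : End F A) (β : End F M) : End F (A →ₗ[F] M) :=
  LinearMap.compRight F β - LinearMap.lcomp F M α

@[simp]
theorem theta_apply (α : End F A) (β : End F M) (f : A →ₗ[F] M) (x : A) :
    theta α β f x = β (f x) - f (α x) := rfl

@[simp]
theorem theta_zero : theta (0 : End F A) (0 : End F M) = 0 := by
  ext; simp

theorem theta_add (α α' : End F A) (β β' : End F M) :
    theta (α + α') (β + β') = theta α β + theta α' β' := by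
  ext; simp; abel

theorem theta_smul (c : F) (α : End F A) (β : End F M) :
    theta (c • α) (c • β) = c • theta α β := by
  ext; simp [smul_sub]

theorem theta_lie (α α' : End F A) (β β' : End F M) :
    theta ⁅α, α'⁆ ⁅β, β'⁆ = ⁅theta α β, theta α' β'⁆ := by
  ext; simp [LieRing.of_associative_ring_bracket]; abel

theorem sub_pow_prime_of_commute {R : Type*} [Ring R] [Algebra F R] (p : ℕ) [Fact p.Prime]
    [CharP F p] {a b : R} (h : Commute a b) : (a - b) ^ p = a ^ p - b ^ p := by
  cases subsingleton_or_nontrivial R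
  · exact Subsingleton.elim _ _
  · have : CharP R p := charP_of_injective_algebraMap (algebraMap F R).injective p
    exact sub_pow_char_of_commute _ h

/-- Pre- and postcomposition commute, so in characteristic `p` the `p`-th power of their difference
is the difference of their `p`-th powers. -/
theorem theta_pow (p : ℕ) [Fact p.Prime] [CharP F p] (α : End F A) (β : End F M) :
    theta (α ^ p) (β ^ p) = theta α β ^ p := by
  have hc : Commute (LinearMap.compRight F β : End F (A →ₗ[F] M)) (LinearMap.lcomp F M α) := by
    ext; simp
  have h₁ (n : ℕ) : (LinearMap.compRight F β : End F (A →ₗ[F] M)) ^ n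
      = LinearMap.compRight F (β ^ n) := by
    induction n with
    | zero => ext; simp
    | succ n ih => ext; simp [pow_succ', ih]
  have h₂ (n : ℕ) : (LinearMap.lcomp F M α : End F (A →ₗ[F] M)) ^ n
      = LinearMap.lcomp F M (α ^ n) := by
    induction n with
    | zero => ext; simp
    | succ n ih => ext; simp [pow_succ' (LinearMap.lcomp F M α), pow_succ α, ih]
  rw [theta, theta, sub_pow_prime_of_commute (F := F) p hc, h₁, h₂]

theorem pow_apply_mem {V : Type*} [AddCommGroup V] [Module F V] {Z B : Submodule F V}
    (hBZ : B ≤ Z) {g : End F V} (hg : ∀ v ∈ Z, g v ∈ B) {n : ℕ} (hn : n ≠ 0) :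
    ∀ v ∈ Z, (g ^ n) v ∈ B := by
  obtain ⟨n, rfl⟩ := Nat.exists_eq_succ_of_ne_zero hn
  clear hn
  induction n with
  | zero => simpa using hg
  | succ n ih =>
    intro v hv
    rw [pow_succ, End.mul_apply]
    exact ih _ (hBZ (hg v hv))

theorem lie_apply_mem {V : Type*} [AddCommGroup V] [Module F V] {Z B : Submodule F V}
    (hBZ : B ≤ Z) {g h : End F V} (hg : ∀ v ∈ Z, g v ∈ B) (hh : ∀ v ∈ Z, h v ∈ B) :
    ∀ v ∈ Z, ⁅g, h⁆ v ∈ B := fun v hv =>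
  B.sub_mem (hg _ (hBZ (hh v hv))) (hh _ (hBZ (hg v hv)))

end Operators

/-! ### Trivial action on cohomology -/

section ActsTrivially

variable {F A M : Type*} [Field F] [LieRing A] [LieAlgebra F A] [AddCommGroup M] [Module F M]
  [LieRingModule A M] [LieModule F A M]

theorem mem_Z1_iff {f : A →ₗ[F] M} :
    f ∈ Z1 F A M ↔ ∀ x y, ⁅x, f y⁆ - ⁅y, f x⁆ - f ⁅x, y⁆ = 0 := by
  rw [Z1, LinearMap.mem_ker]
  refine ⟨fun h x y => by rw [← d₁₂_apply_apply, h]; rfl, fun h => ?_⟩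
  ext x y
  exact h x y

theorem mem_twoCocycle_iff' {f : twoCochain F A M} :
    f ∈ twoCocycle F A M ↔ ∀ x y z, ⁅x, f y z⁆ - ⁅y, f x z⁆ + ⁅z, f x y⁆ - f ⁅x, y⁆ z
      + f ⁅x, z⁆ y - f ⁅y, z⁆ x = 0 := by
  rw [mem_twoCocycle_iff]
  refine ⟨fun h x y z => by rw [← d₂₃_apply, h]; rfl, fun h => ?_⟩
  ext x y z
  exact h x y z

/-- The operator on cochains given by an endomorphism of the Lie algebra and one of the module maps
cocycles to coboundaries in degrees at most two. -/
structure ActsTrivially (α : End F A) (β : End F M) : Prop where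
  zero : ∀ m ∈ LinearMap.ker (d₀₁ F A M), β m ∈ (⊥ : Submodule F M)
  one : ∀ f ∈ Z1 F A M, theta α β f ∈ B1 F A M
  -- Applying `theta` twice gives `β (f x y) - f x (α y) - f (α x) y`. It is defined on all bilinear
  -- maps, hence the images under the inclusion.
  two : ∀ f ∈ (twoCocycle F A M).map (twoCochain F A M).subtype,
    theta α (theta α β) f ∈ (B2 F A M).map (twoCochain F A M).subtype

namespace ActsTrivially

variable {α α' : End F A} {β β' : End F M}

theorem of_zero : ActsTrivially (0 : End F A) (0 : End F M) where
  zero := by simp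
  one := by simp
  two f _ := by simp only [theta_zero, LinearMap.zero_apply]; exact zero_mem _

theorem add (h : ActsTrivially α β) (h' : ActsTrivially α' β') :
    ActsTrivially (α + α') (β + β') where
  zero m hm := add_mem (h.zero m hm) (h'.zero m hm)
  one f hf := by
    rw [theta_add]
    exact add_mem (h.one f hf) (h'.one f hf)
  two f hf := by
    rw [theta_add, theta_add]
    exact add_mem (h.two f hf) (h'.two f hf)

theorem smul (c : F) (h : ActsTrivially α β) : ActsTrivially (c • α) (c • β) where
  zero m hm := Submodule.smul_mem _ c (h.zero m hm)
  one f hf := by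
    rw [theta_smul]
    exact Submodule.smul_mem _ c (h.one f hf)
  two f hf := by
    rw [theta_smul, theta_smul]
    exact Submodule.smul_mem _ c (h.two f hf)

theorem sub (h : ActsTrivially α β) (h' : ActsTrivially α' β') :
    ActsTrivially (α - α') (β - β') := by
  simpa [sub_eq_add_neg] using h.add (h'.smul (-1))

theorem lie (h : ActsTrivially α β) (h' : ActsTrivially α' β') :
    ActsTrivially ⁅α, α'⁆ ⁅β, β'⁆ where
  zero := lie_apply_mem bot_le h.zero h'.zero
  one := by
    rw [theta_lie]
    exact lie_apply_mem (B1_le_Z1 F A M) h.one h'.one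
  two := by
    rw [theta_lie, theta_lie]
    exact lie_apply_mem (Submodule.map_mono (B2_le_twoCocycle F A M)) h.two h'.two

theorem pow (p : ℕ) [hp : Fact p.Prime] [CharP F p] (h : ActsTrivially α β) :
    ActsTrivially (α ^ p) (β ^ p) where
  zero := pow_apply_mem bot_le h.zero hp.out.ne_zero
  one := by
    rw [theta_pow]
    exact pow_apply_mem (B1_le_Z1 F A M) h.one hp.out.ne_zero
  two := by
    rw [theta_pow, theta_pow]
    exact pow_apply_mem (Submodule.map_mono (B2_le_twoCocycle F A M)) h.two hp.out.ne_zero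

/-- Cartan's formula: a Lie algebra acts trivially on its cohomology. -/
theorem ad_toEnd (x : A) : ActsTrivially (LieAlgebra.ad F A x) (LieModule.toEnd F A M x) where
  zero m hm := by
    rw [Submodule.mem_bot]
    exact LinearMap.congr_fun hm x
  one f hf := by
    -- The contraction of the cocycle with `x` is the primitive; likewise in degree two.
    refine ⟨f x, ?_⟩
    ext y
    have := mem_Z1_iff.1 hf x y
    simp only [d₀₁, theta_apply, LieModule.toEnd_apply_apply, LieAlgebra.ad_apply,
      LinearMap.coe_mk, AddHom.coe_mk]
    linear_combination (norm := module) -this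
  two := by
    rintro _ ⟨f, hf, rfl⟩
    refine ⟨_, ⟨f.1 x, rfl⟩, ?_⟩
    ext y z
    have := mem_twoCocycle_iff'.1 hf x y z
    have h₁ := twoCochain_skew f y ⁅x, z⁆
    have h₂ := twoCochain_skew f x ⁅y, z⁆
    simp only [theta_apply, LinearMap.sub_apply, LieModule.toEnd_apply_apply,
      LieAlgebra.ad_apply, Submodule.subtype_apply, twoCochain_val_apply, d₁₂_apply_apply] at *
    rw [← h₁, ← h₂] at this
    rw [← sub_eq_zero, ← neg_eq_zero, ← this]
    abel

end ActsTrivially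

end ActsTrivially

end LieCohomology

/-! ### Cocycles under an extension of codimension one -/

namespace LieCohomology

open LieModule.Cohomology Module

/-- For maps `g : V → X` and `d : U → X` and a subspace `Z` of `V`, the pairs `(v, u)` with `v ∈ Z`
and `g v = d u`. -/
def fiberProduct {F V U X : Type*} [Field F] [AddCommGroup V] [Module F V] [AddCommGroup U]
    [Module F U] [AddCommGroup X] [Module F X] (Z : Submodule F V) (g : V →ₗ[F] X)
    (d : U →ₗ[F] X) : Submodule F (V × U) :=
  Z.comap (LinearMap.fst F V U) ⊓
    LinearMap.eqLocus (g ∘ₗ LinearMap.fst F V U) (d ∘ₗ LinearMap.snd F V U)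

theorem finrank_fiberProduct {F V U X : Type*} [Field F] [AddCommGroup V] [Module F V]
    [AddCommGroup U] [Module F U] [AddCommGroup X] [Module F X] [FiniteDimensional F V]
    [FiniteDimensional F U] (Z : Submodule F V) (g : V →ₗ[F] X) (d : U →ₗ[F] X)
    (h : ∀ v ∈ Z, g v ∈ LinearMap.range d) :
    finrank F (fiberProduct Z g d) = finrank F Z + finrank F (LinearMap.ker d) := by
  let q : fiberProduct Z g d →ₗ[F] Z :=
    (LinearMap.fst F V U ∘ₗ (fiberProduct Z g d).subtype).codRestrict Z fun w => w.2.1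
  have hq : Function.Surjective q := by
    rintro ⟨v, hv⟩
    obtain ⟨u, hu⟩ := h v hv
    exact ⟨⟨(v, u), hv, hu.symm⟩, rfl⟩
  let e : LinearMap.ker d ≃ₗ[F] LinearMap.ker q :=
    { toFun u := ⟨⟨(0, u), Z.zero_mem, by simp⟩, rfl⟩
      map_add' _ _ := by ext <;> simp
      map_smul' _ _ := by ext <;> simp
      invFun w := ⟨w.1.1.2, by
        have h₁ : w.1.1.1 = 0 := congrArg Subtype.val w.2
        have h₂ : g w.1.1.1 = d w.1.1.2 := w.1.2.2
        rw [LinearMap.mem_ker, ← h₂, h₁, map_zero]⟩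
      left_inv _ := rfl
      right_inv w := by
        have h₁ : w.1.1.1 = 0 := congrArg Subtype.val w.2
        ext
        · exact h₁.symm
        · rfl }
  rw [← LinearMap.finrank_range_add_finrank_ker q, LinearMap.range_eq_top.2 hq, finrank_top,
    e.finrank_eq]

/-- `B` is spanned by the image of `j : A → B` and an element `t` outside of it, `α` is the
restriction of `ad t` to `A`, and `P`, `c` are the coordinates with respect to this decomposition. -/
structure IsCodimOne {F A B : Type*} [Field F] [LieRing A] [LieAlgebra F A] [LieRing B]
    [LieAlgebra F B] (j : A →ₗ⁅F⁆ B) (t : B) (α : End F A) (P : B →ₗ[F] A) (c : B →ₗ[F] F) :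
    Prop where
  decomp : ∀ b, j (P b) + c b • t = b
  P_j : ∀ a, P (j a) = a
  c_j : ∀ a, c (j a) = 0
  P_t : P t = 0
  c_t : c t = 1
  j_α : ∀ a, j (α a) = ⁅t, j a⁆

namespace IsCodimOne

variable {F A B M : Type*} [Field F] [LieRing A] [LieAlgebra F A] [LieRing B]
    [LieAlgebra F B] [AddCommGroup M] [Module F M] [LieRingModule A M] [LieModule F A M]
    [LieRingModule B M] [LieModule F B M]
    {j : A →ₗ⁅F⁆ B} {t : B} {α : End F A} {P : B →ₗ[F] A} {c : B →ₗ[F] F}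

theorem ker_d₀₁_eq (h : IsCodimOne j t α P c) (hj : ∀ a (m : M), ⁅j a, m⁆ = ⁅a, m⁆)
    (hα : ActsTrivially α (LieModule.toEnd F B M t)) :
    LinearMap.ker (d₀₁ F B M) = LinearMap.ker (d₀₁ F A M) := by
  have key (m : M) (hm : m ∈ LinearMap.ker (d₀₁ F A M)) (a : A) : ⁅a, m⁆ = 0 :=
    LinearMap.congr_fun hm a
  ext m
  refine ⟨fun hm => ?_, fun hm => ?_⟩
  · ext a
    simpa [hj, d₀₁] using LinearMap.congr_fun hm (j a)
  · ext b
    have h₁ : ⁅t, m⁆ = 0 := hα.zero m hm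
    change ⁅b, m⁆ = 0
    rw [← h.decomp b, add_lie, smul_lie, hj, key m hm, h₁, smul_zero, add_zero]

/-- Linear maps on `B` in terms of their restriction to `A` and their value at `t`. -/
def oneCochainEquiv (h : IsCodimOne j t α P c) : (B →ₗ[F] M) ≃ₗ[F] (A →ₗ[F] M) × M where
  toFun f := (f ∘ₗ (j : A →ₗ[F] B), f t)
  map_add' _ _ := rfl
  map_smul' _ _ := rfl
  invFun w := w.1 ∘ₗ P + c.smulRight w.2
  left_inv f := by
    ext b
    conv_rhs => rw [← h.decomp b]
    simp
  right_inv w := by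
    ext
    · simp [h.P_j, h.c_j]
    · simp [h.P_t, h.c_t]

/-- The cocycle identity is alternating, so it suffices to test it with `t` in no slot (a cocycle on
`A`) or in one slot (the fiber product equation). -/
theorem Z1_eq_comap (h : IsCodimOne j t α P c) (hj : ∀ a (m : M), ⁅j a, m⁆ = ⁅a, m⁆) :
    Z1 F B M = (fiberProduct (Z1 F A M) (theta α (LieModule.toEnd F B M t))
      (d₀₁ F A M)).comap (h.oneCochainEquiv (M := M) : _ →ₗ[F] _) := by
  ext f
  rw [mem_Z1_iff]
  refine ⟨fun hf => ⟨?_, ?_⟩, fun ⟨h₁, h₂⟩ b b' => ?_⟩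
  · refine mem_Z1_iff.2 fun x y => ?_
    simpa [oneCochainEquiv, hj] using hf (j x) (j y)
  · ext a
    have := hf t (j a)
    rw [← h.j_α, hj] at this
    change ⁅t, f (j a)⁆ - f (j (α a)) = ⁅a, f t⁆
    rw [← sub_eq_zero, ← this]
    abel
  · have h₁' (x y : A) : ⁅x, f (j y)⁆ - ⁅y, f (j x)⁆ - f (j ⁅x, y⁆) = 0 := mem_Z1_iff.1 h₁ x y
    have h₂' (a : A) : ⁅t, f (j a)⁆ - f (j (α a)) = ⁅a, f t⁆ := LinearMap.congr_fun h₂ a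
    rw [← h.decomp b, ← h.decomp b']
    generalize P b = x, P b' = y, c b = r, c b' = s
    have e : ⁅j x, t⁆ = - j (α x) := by rw [h.j_α, lie_skew]
    simp only [map_add, map_smul, add_lie, lie_add, smul_lie, lie_smul, hj, ← LieHom.map_lie,
      ← h.j_α, lie_self, smul_zero, e, map_neg, map_zero]
    linear_combination (norm := module) h₁' x y + r • h₂' y - s • h₂' x

theorem finrank_Z1 [FiniteDimensional F A] [FiniteDimensional F M] (h : IsCodimOne j t α P c)
    (hj : ∀ a (m : M), ⁅j a, m⁆ = ⁅a, m⁆)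
    (hα : ActsTrivially α (LieModule.toEnd F B M t)) :
    finrank F (Z1 F B M) = finrank F (Z1 F A M) + finrank F (LinearMap.ker (d₀₁ F A M)) := by
  rw [h.Z1_eq_comap hj, LinearEquiv.finrank_eq (h.oneCochainEquiv.ofSubmodule' _),
    finrank_fiberProduct _ _ _ hα.one]

/-- Alternating maps on `B` in terms of their restriction to `A` and their contraction with `t`. -/
def twoCochainEquiv (h : IsCodimOne j t α P c) :
    twoCochain F B M ≃ₗ[F] twoCochain F A M × (A →ₗ[F] M) where
  toFun f := (⟨f.1.compl₁₂ (j : A →ₗ[F] B) (j : A →ₗ[F] B), fun x => f.2 (j x)⟩,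
    f.1 t ∘ₗ (j : A →ₗ[F] B))
  map_add' _ _ := rfl
  map_smul' _ _ := rfl
  -- The pullback of the form on `A` along `P`, plus the wedge of `c` with the contraction.
  invFun w := ⟨w.1.1.compl₁₂ P P + c.smulRight (w.2 ∘ₗ P) - (c.smulRight (w.2 ∘ₗ P)).flip,
    fun b => by simp⟩
  left_inv f := by
    ext b b'
    have e : f.1 (j (P b)) t = - f.1 t (j (P b)) := (twoCochain_skew f t (j (P b))).symm
    have e' : f.1 t t = 0 := f.2 t
    conv_rhs => rw [← h.decomp b, ← h.decomp b']
    simp [-twoCochain_val_apply, e, e']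
    abel
  right_inv w := by
    ext
    · simp [h.P_j, h.c_j]
    · simp [h.P_j, h.c_j, h.P_t, h.c_t]

/-- As in degree one, the identity is tested with `t` in no slot or in one slot. -/
theorem twoCocycle_eq_comap (h : IsCodimOne j t α P c) (hj : ∀ a (m : M), ⁅j a, m⁆ = ⁅a, m⁆) :
    twoCocycle F B M = (fiberProduct (twoCocycle F A M)
      (theta α (theta α (LieModule.toEnd F B M t)) ∘ₗ (twoCochain F A M).subtype)
      ((twoCochain F A M).subtype ∘ₗ d₁₂ F A M)).comap
        (h.twoCochainEquiv (M := M) : _ →ₗ[F] _) := by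
  ext f
  have sk (x y : B) : f x y = - f y x := (twoCochain_skew f y x).symm
  rw [mem_twoCocycle_iff']
  refine ⟨fun hf => ⟨?_, ?_⟩, fun ⟨h₁, h₂⟩ b b' b'' => ?_⟩
  · refine mem_twoCocycle_iff'.2 fun x y z => ?_
    have := hf (j x) (j y) (j z)
    simp only [hj, ← LieHom.map_lie] at this
    exact this
  · ext x y
    have := hf t (j x) (j y)
    simp only [hj, ← LieHom.map_lie, ← h.j_α] at this
    change ⁅t, f (j x) (j y)⁆ - f (j x) (j (α y)) - f (j (α x)) (j y) =
      ⁅x, f t (j y)⁆ - ⁅y, f t (j x)⁆ - f t (j ⁅x, y⁆)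
    rw [sk (j x) (j (α y)), sk t (j ⁅x, y⁆), ← sub_eq_zero, ← this]
    abel
  · have h₁' (x y z : A) : ⁅x, f (j y) (j z)⁆ - ⁅y, f (j x) (j z)⁆ + ⁅z, f (j x) (j y)⁆
        - f (j ⁅x, y⁆) (j z) + f (j ⁅x, z⁆) (j y) - f (j ⁅y, z⁆) (j x) = 0 :=
      mem_twoCocycle_iff'.1 h₁ x y z
    have h₂' (x y : A) : ⁅t, f (j x) (j y)⁆ + f (j (α y)) (j x) - f (j (α x)) (j y) =
        ⁅x, f t (j y)⁆ - ⁅y, f t (j x)⁆ - f t (j ⁅x, y⁆) := by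
      rw [← sub_neg_eq_add, ← sk (j x)]
      exact LinearMap.congr_fun (LinearMap.congr_fun h₂ x) y
    rw [← h.decomp b, ← h.decomp b', ← h.decomp b'']
    generalize P b = x, P b' = y, P b'' = z, c b = r, c b' = s, c b'' = u
    have e (x : A) : ⁅j x, t⁆ = - j (α x) := by rw [h.j_α, lie_skew]
    simp only [map_add, map_smul, add_lie, lie_add, smul_lie, lie_smul, hj, ← LieHom.map_lie,
      ← h.j_α, lie_self, smul_zero, e, map_neg, map_zero, LinearMap.add_apply,
      LinearMap.smul_apply, LinearMap.neg_apply, LinearMap.zero_apply, twoCochain_alt,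
      sk (j _) t, lie_neg, lie_zero]
    linear_combination (norm := module) h₁' x y z + r • h₂' y z - s • h₂' x z + u • h₂' x y

theorem finrank_twoCocycle [FiniteDimensional F A] [FiniteDimensional F M]
    (h : IsCodimOne j t α P c) (hj : ∀ a (m : M), ⁅j a, m⁆ = ⁅a, m⁆)
    (hα : ActsTrivially α (LieModule.toEnd F B M t)) :
    finrank F (twoCocycle F B M) = finrank F (twoCocycle F A M) + finrank F (Z1 F A M) := by
  rw [h.twoCocycle_eq_comap hj, LinearEquiv.finrank_eq (h.twoCochainEquiv.ofSubmodule' _),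
    finrank_fiberProduct, LinearMap.ker_comp_of_ker_eq_bot _ (Submodule.ker_subtype _), Z1]
  intro f hf
  obtain ⟨_, ⟨g, rfl⟩, hg⟩ := hα.two f ⟨f, hf, rfl⟩
  exact ⟨g, hg⟩

end IsCodimOne

end LieCohomology

namespace LieCohomology

open LieModule.Cohomology Module

/-! ### Invariance of cocycles under isomorphism -/

section Transport

variable {F A B M : Type*} [Field F] [LieRing A] [LieAlgebra F A] [LieRing B]
    [LieAlgebra F B] [AddCommGroup M] [Module F M] [LieRingModule A M] [LieModule F A M]
    [LieRingModule B M] [LieModule F B M]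

theorem ker_d₀₁_eq_of_equiv (j : A ≃ₗ⁅F⁆ B) (hj : ∀ a (m : M), ⁅j a, m⁆ = ⁅a, m⁆) :
    LinearMap.ker (d₀₁ F B M) = LinearMap.ker (d₀₁ F A M) := by
  ext m
  simp only [LinearMap.mem_ker, LinearMap.ext_iff]
  refine j.surjective.forall.trans (forall_congr' fun a => ?_)
  change ⁅j a, m⁆ = 0 ↔ ⁅a, m⁆ = 0
  rw [hj]

theorem finrank_Z1_eq_of_equiv (j : A ≃ₗ⁅F⁆ B) (hj : ∀ a (m : M), ⁅j a, m⁆ = ⁅a, m⁆) :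
    finrank F (Z1 F B M) = finrank F (Z1 F A M) := by
  have hj' (a : A) (m : M) : ⁅j.toLieHom a, m⁆ = ⁅a, m⁆ := hj a m
  let e : (B →ₗ[F] M) ≃ₗ[F] (A →ₗ[F] M) :=
    LinearEquiv.congrLeft M F j.symm.toLinearEquiv
  have : Z1 F B M = (Z1 F A M).comap (e : _ →ₗ[F] _) := by
    ext f
    rw [mem_Z1_iff, Submodule.mem_comap, mem_Z1_iff, j.surjective.forall₂]
    refine forall₂_congr fun x y => ?_
    rw [hj', hj', ← LieHom.map_lie]
    rfl
  rw [this, LinearEquiv.finrank_eq (e.ofSubmodule' _)]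

theorem finrank_twoCocycle_eq_of_equiv (j : A ≃ₗ⁅F⁆ B) (hj : ∀ a (m : M), ⁅j a, m⁆ = ⁅a, m⁆) :
    finrank F (twoCocycle F B M) = finrank F (twoCocycle F A M) := by
  have hj' (a : A) (m : M) : ⁅j.toLieHom a, m⁆ = ⁅a, m⁆ := hj a m
  let e : twoCochain F B M ≃ₗ[F] twoCochain F A M :=
    { toFun f := ⟨f.1.compl₁₂ (j : A →ₗ[F] B) (j : A →ₗ[F] B), fun x => f.2 (j x)⟩
      map_add' _ _ := rfl
      map_smul' _ _ := rfl
      invFun f := ⟨f.1.compl₁₂ (j.symm : B →ₗ[F] A) (j.symm : B →ₗ[F] A),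
        fun x => f.2 (j.symm x)⟩
      left_inv f := by ext; simp
      right_inv f := by ext; simp }
  have : twoCocycle F B M = (twoCocycle F A M).comap (e : _ →ₗ[F] _) := by
    ext f
    rw [mem_twoCocycle_iff', Submodule.mem_comap, mem_twoCocycle_iff', j.surjective.forall₃]
    refine forall₃_congr fun x y z => ?_
    rw [hj', hj', hj', ← LieHom.map_lie, ← LieHom.map_lie, ← LieHom.map_lie]
    rfl
  rw [this, LinearEquiv.finrank_eq (e.ofSubmodule' _)]

end Transport

/-! ### Dimensions of cohomology from dimensions of cocycles -/

section Dimensions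

variable (F A M : Type*) [Field F] [LieRing A] [LieAlgebra F A] [AddCommGroup M] [Module F M]
  [LieRingModule A M] [LieModule F A M] [FiniteDimensional F A] [FiniteDimensional F M]

theorem finrank_H1_add :
    finrank F (H1 F A M) + finrank F M = finrank F (Z1 F A M) + finrank F (LinearMap.ker (d₀₁ F A M)) := by
  have h₁ := Submodule.finrank_quotient_add_finrank ((B1 F A M).submoduleOf (Z1 F A M))
  have h₂ := LinearMap.finrank_range_add_finrank_ker (d₀₁ F A M)
  have h₃ : finrank F (B1 F A M) = finrank F (LinearMap.range (d₀₁ F A M)) := rfl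
  rw [(Submodule.submoduleOfEquivOfLe (B1_le_Z1 F A M)).finrank_eq] at h₁
  unfold H1
  omega

theorem finrank_H2_add :
    finrank F (H2 F A M) + finrank F A * finrank F M =
      finrank F (twoCocycle F A M) + finrank F (Z1 F A M) := by
  have h₁ := Submodule.finrank_quotient_add_finrank
    ((B2 F A M).submoduleOf (twoCocycle F A M))
  have h₂ := LinearMap.finrank_range_add_finrank_ker (d₁₂ F A M)
  have h₃ : finrank F (B2 F A M) = finrank F (LinearMap.range (d₁₂ F A M)) := rfl
  rw [(Submodule.submoduleOfEquivOfLe (B2_le_twoCocycle F A M)).finrank_eq] at h₁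
  rw [finrank_linearMap] at h₂
  unfold H2 Z1
  omega

end Dimensions

/-! ### The chain of subalgebras up to the whole algebra -/

section Chain

variable {F E M : Type*} [Field F] [LieRing E] [LieAlgebra F E] [AddCommGroup M] [Module F M]
  [LieRingModule E M] [LieModule F E M]

/-- The restriction of `ad e` to a subspace containing all brackets. -/
def adOn (K : LieSubalgebra F E) (hK : ∀ x y : E, ⁅x, y⁆ ∈ K) (e : E) : End F K :=
  (LieAlgebra.ad F E e).restrict (p := K.toSubmodule) (q := K.toSubmodule) fun x _ => hK e x

@[simp]
theorem coe_adOn (K : LieSubalgebra F E) (hK : ∀ x y : E, ⁅x, y⁆ ∈ K) (e : E) (x : K) :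
    (adOn K hK e x : E) = ⁅e, (x : E)⁆ := rfl

/-- The dimensions of the spaces of cocycles of a subalgebra of `E` containing `K₀`, if it has
codimension `d` in it. -/
structure CocycleDims (M : Type*) [AddCommGroup M] [Module F M]
    [LieRingModule E M] [LieModule F E M] (K₀ K : LieSubalgebra F E) (d : ℕ) : Prop where
  dim : finrank F K = finrank F K₀ + d
  zero : finrank F (LinearMap.ker (d₀₁ F K M)) = finrank F (LinearMap.ker (d₀₁ F K₀ M))
  one : finrank F (Z1 F K M) =
    finrank F (Z1 F K₀ M) + d * finrank F (LinearMap.ker (d₀₁ F K₀ M))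
  two : finrank F (twoCocycle F K M) = finrank F (twoCocycle F K₀ M)
    + d * finrank F (Z1 F K₀ M) + d.choose 2 * finrank F (LinearMap.ker (d₀₁ F K₀ M))

theorem CocycleDims.exists_succ [FiniteDimensional F E] [FiniteDimensional F M]
    {K₀ K : LieSubalgebra F E} {d : ℕ} (h : CocycleDims M K₀ K d) (hK : ∀ x y : E, ⁅x, y⁆ ∈ K)
    (hact : ∀ e : E, ActsTrivially (adOn K hK e) (LieModule.toEnd F E M e)) (hne : K ≠ ⊤) :
    ∃ K', K ≤ K' ∧ CocycleDims M K₀ K' (d + 1) := by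
  obtain ⟨t, ht⟩ : ∃ t, t ∉ K := by
    by_contra! hc
    exact hne (eq_top_iff.2 fun x _ => hc x)
  -- Any subspace containing `K` is a subalgebra, since `K` contains all brackets of `E`.
  let K' : LieSubalgebra F E :=
    { K.toSubmodule ⊔ Submodule.span F {t} with
      lie_mem' := fun {x y} _ _ => Submodule.mem_sup_left (hK x y) }
  have hKK' : K ≤ K' := fun x hx => Submodule.mem_sup_left hx
  let t' : K' := ⟨t, Submodule.mem_sup_right (Submodule.mem_span_singleton_self t)⟩
  let j : K →ₗ⁅F⁆ K' := LieSubalgebra.inclusion hKK'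
  let s : (K × F) →ₗ[F] K' := (j : K →ₗ[F] K').coprod (LinearMap.toSpanSingleton F K' t')
  have hs (a : K) (r : F) : s (a, r) = j a + r • t' := by simp [s]
  have hinj : Function.Injective s := by
    rw [injective_iff_map_eq_zero]
    rintro ⟨a, r⟩ hw
    have hw' : (a : E) + r • t = 0 := by
      rw [hs] at hw
      exact congrArg Subtype.val hw
    have hr : r = 0 := by
      by_contra hr
      refine ht ((Submodule.smul_mem_iff K.toSubmodule hr).1 ?_)
      rw [eq_neg_of_add_eq_zero_right hw']
      exact neg_mem a.2
    subst hr
    rw [zero_smul, add_zero] at hw'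
    ext
    · exact hw'
    · rfl
  have hsurj : Function.Surjective s := by
    rintro ⟨x, hx⟩
    obtain ⟨y, hy, z, hz, rfl⟩ := Submodule.mem_sup.1 hx
    obtain ⟨r, rfl⟩ := Submodule.mem_span_singleton.1 hz
    exact ⟨(⟨y, hy⟩, r), by rw [hs]; rfl⟩
  let e := LinearEquiv.ofBijective s ⟨hinj, hsurj⟩
  have hej (a : K) : e.symm (j a) = (a, 0) := by
    rw [LinearEquiv.symm_apply_eq]
    exact .symm ((hs a 0).trans (by simp))
  have het : e.symm t' = (0, 1) := by
    rw [LinearEquiv.symm_apply_eq]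
    exact .symm ((hs 0 1).trans (by simp))
  have hc : IsCodimOne j t' (adOn K hK t) (LinearMap.fst F K F ∘ₗ e.symm)
      (LinearMap.snd F K F ∘ₗ e.symm) :=
    { decomp b := by
        rw [← e.apply_symm_apply b, LinearMap.comp_apply, LinearMap.comp_apply,
          LinearEquiv.coe_coe, e.symm_apply_apply]
        exact (hs _ _).symm
      P_j a := by simp [hej]
      c_j a := by simp [hej]
      P_t := by simp [het]
      c_t := by simp [het]
      j_α a := rfl }
  have hj (a : K) (m : M) : ⁅j a, m⁆ = ⁅a, m⁆ := rfl
  have hα : ActsTrivially (adOn K hK t) (LieModule.toEnd F K' M t') := hact t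
  refine ⟨K', hKK', ?_, ?_, ?_, ?_⟩
  · rw [← e.finrank_eq, finrank_prod, h.dim, finrank_self, add_assoc]
  · rw [hc.ker_d₀₁_eq hj hα, h.zero]
  · rw [hc.finrank_Z1 hj hα, h.zero, h.one]
    ring
  -- Pascal's rule: the degree one count contributes `d` further copies of the invariants.
  · rw [hc.finrank_twoCocycle hj hα, h.one, h.two, Nat.choose_succ_succ' d 1, Nat.choose_one_right]
    ring

theorem exists_cocycleDims [FiniteDimensional F E] [FiniteDimensional F M]
    {K₀ : LieSubalgebra F E} (hK₀ : ∀ x y : E, ⁅x, y⁆ ∈ K₀)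
    (hact : ∀ (K : LieSubalgebra F E) (hK : K₀ ≤ K) (e : E),
      ActsTrivially (adOn K (fun x y => hK (hK₀ x y)) e) (LieModule.toEnd F E M e))
    (d : ℕ) (hd : finrank F K₀ + d ≤ finrank F E) : ∃ K, K₀ ≤ K ∧ CocycleDims M K₀ K d := by
  induction d with
  | zero => exact ⟨K₀, le_rfl, by constructor <;> simp⟩
  | succ d ih =>
    obtain ⟨K, hK, h⟩ := ih (by omega)
    obtain ⟨K', hK', h'⟩ := h.exists_succ (fun x y => hK (hK₀ x y)) (hact K hK) (by
      rintro rfl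
      have h₁ := h.dim
      have h₂ : finrank F (⊤ : LieSubalgebra F E) = finrank F E := finrank_top F E
      omega)
    exact ⟨K', hK.trans hK', h'⟩

theorem cocycleDims_top [FiniteDimensional F E] [FiniteDimensional F M]
    {K₀ : LieSubalgebra F E} (hK₀ : ∀ x y : E, ⁅x, y⁆ ∈ K₀)
    (hact : ∀ (K : LieSubalgebra F E) (hK : K₀ ≤ K) (e : E),
      ActsTrivially (adOn K (fun x y => hK (hK₀ x y)) e) (LieModule.toEnd F E M e)) :
    CocycleDims M K₀ ⊤ (finrank F (E ⧸ K₀.toSubmodule)) := by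
  have h₁ : finrank F (E ⧸ K₀.toSubmodule) + finrank F K₀ = finrank F E :=
    Submodule.finrank_quotient_add_finrank K₀.toSubmodule
  obtain ⟨K, -, h⟩ := exists_cocycleDims hK₀ hact (finrank F (E ⧸ K₀.toSubmodule)) (by omega)
  have h₂ : finrank F K.toSubmodule = finrank F E := by
    have : finrank F K = finrank F K.toSubmodule := rfl
    have := h.dim
    omega
  have : K = ⊤ := LieSubalgebra.toSubmodule_injective (Submodule.eq_top_of_finrank_eq h₂)
  rwa [this] at h

end Chain

end LieCohomology

/-! ### Trivial action of a `p`-envelope -/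

namespace RestrictedLie

open Module LieCohomology

variable {F : Type*} [Field F] {p : ℕ}

/-- An induction principle for Lie algebras generated by a subset as restricted Lie algebras. -/
theorem pSpan_induction {E : Type*} [LieRing E] [LieAlgebra F E] {pm : E → E} {S : Set E}
    (hS : pSpan F pm S = ⊤) {Q : E → Prop} (mem : ∀ x ∈ S, Q x) (zero : Q 0)
    (add : ∀ x y, Q x → Q y → Q (x + y)) (smul : ∀ (c : F) x, Q x → Q (c • x))
    (lie : ∀ x y, Q x → Q y → Q ⁅x, y⁆) (pmap : ∀ x, Q x → Q (pm x)) (x : E) : Q x := by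
  let K : LieSubalgebra F E :=
    { carrier := {x | Q x}
      zero_mem' := zero
      add_mem' := fun {x y} => add x y
      smul_mem' := smul
      lie_mem' := fun {x y} => lie x y }
  have hK : pSpan F pm S ≤ K := sInf_le ⟨mem, pmap⟩
  rw [hS] at hK
  exact hK (LieSubalgebra.mem_top x)

section

variable {L E : Type*} [LieRing L] [LieAlgebra F L] [LieRing E] [LieAlgebra F E] {pm : E → E}
  {ι : L →ₗ⁅F⁆ E}

theorem IsPMap.lie_pm (h : IsPMap F p pm) (x y : E) :
    ⁅pm x, y⁆ = ((LieAlgebra.ad F E x) ^ p) y := by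
  rw [← h.ad_pm]
  rfl

theorem IsPEnvelope.lie_mem_of_mem [Fact p.Prime] (h : IsPEnvelope F p pm ι) (e : E) :
    ∀ x ∈ ι.range, ⁅e, x⁆ ∈ ι.range := by
  induction e using pSpan_induction h.pSpan_eq_top with
  | mem y hy => exact fun x hx => ι.range.lie_mem ((ι.mem_range _).2 hy) hx
  | zero => intro x _; rw [zero_lie]; exact zero_mem _
  | add a b ha hb => intro x hx; rw [add_lie]; exact add_mem (ha x hx) (hb x hx)
  | smul c a ha => intro x hx; rw [smul_lie]; exact ι.range.smul_mem c (ha x hx)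
  | lie a b ha hb =>
    intro x hx
    rw [lie_lie]
    exact sub_mem (ha _ (hb x hx)) (hb _ (ha x hx))
  | pmap a ha =>
    intro x hx
    rw [h.isPMap.lie_pm]
    exact pow_apply_mem (Z := ι.range.toSubmodule) le_rfl ha (Fact.out : p.Prime).ne_zero x hx

/-- The elements `e` with `[e, E] ⊆ ι(L)` contain `ι(L)`, an ideal by `lie_mem_of_mem`, and are
closed under the `p`-mapping because `ad (pm e) = (ad e)ᵖ`. -/
theorem IsPEnvelope.lie_mem [Fact p.Prime] (h : IsPEnvelope F p pm ι) (e y : E) :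
    ⁅e, y⁆ ∈ ι.range := by
  revert y
  induction e using pSpan_induction h.pSpan_eq_top with
  | mem x hx =>
    intro y
    rw [← lie_skew]
    exact neg_mem (h.lie_mem_of_mem y x ((ι.mem_range _).2 hx))
  | zero => intro x; rw [zero_lie]; exact zero_mem _
  | add a b ha hb => intro x; rw [add_lie]; exact add_mem (ha x) (hb x)
  | smul c a ha => intro x; rw [smul_lie]; exact ι.range.smul_mem c (ha x)
  | lie a b ha hb =>
    intro x
    rw [lie_lie]
    exact sub_mem (ha _) (hb _)
  | pmap a ha =>
    intro x
    rw [h.isPMap.lie_pm]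
    exact pow_apply_mem (Z := ⊤) (B := ι.range.toSubmodule) le_top (fun v _ => ha v)
      (Fact.out : p.Prime).ne_zero x trivial

/-- An element that commutes with `L` is central in every `p`-envelope. -/
theorem IsPEnvelope.lie_eq_zero [Fact p.Prime] (h : IsPEnvelope F p pm ι) {z : E}
    (hz : ∀ x, ⁅ι x, z⁆ = 0) (e : E) : ⁅e, z⁆ = 0 := by
  induction e using pSpan_induction h.pSpan_eq_top with
  | mem x hx =>
    obtain ⟨x, rfl⟩ := hx
    exact hz x
  | zero => simp
  | add a b ha hb => simp [ha, hb]
  | smul c a ha => simp [ha]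
  | lie a b ha hb => simp [ha, hb]
  | pmap a ha =>
    obtain ⟨n, hn⟩ := Nat.exists_eq_succ_of_ne_zero (Fact.out : p.Prime).ne_zero
    rw [h.isPMap.lie_pm, hn, pow_succ, End.mul_apply, LieAlgebra.ad_apply, ha, map_zero]

end

variable {L E U M : Type*} [LieRing L] [LieAlgebra F L] [LieRing E] [LieAlgebra F E]
  [LieRing U] [LieAlgebra F U] [AddCommGroup M] [Module F M] [LieRingModule E M] [LieModule F E M]
  {pm : E → E} {ι : L →ₗ⁅F⁆ E} {pmU : U → U} {ιU : L →ₗ⁅F⁆ U}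
  {ρ : U →ₗ⁅F⁆ End F M} {φ : E →ₗ⁅F⁆ U}

/-- `e ∈ E` and `u ∈ U` induce the same derivation of `L`, and they act trivially on the cohomology
of `K` through the adjoint action of `e` and the action of `u` on `M`. -/
structure ActsTriviallyOn (ι : L →ₗ⁅F⁆ E) (ιU : L →ₗ⁅F⁆ U) (ρ : U →ₗ⁅F⁆ End F M) (φ : E →ₗ⁅F⁆ U)
    (K : LieSubalgebra F E) (hK : ∀ x y : E, ⁅x, y⁆ ∈ K) (e : E) (u : U) : Prop where
  lie_eq : ∀ x, ⁅φ e, ιU x⁆ = ⁅u, ιU x⁆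
  acts : ActsTrivially (adOn K hK e) (ρ u)

namespace ActsTriviallyOn

variable {K : LieSubalgebra F E} {hK : ∀ x y : E, ⁅x, y⁆ ∈ K} {e e' : E} {u u' : U}

theorem zero : ActsTriviallyOn ι ιU ρ φ K hK 0 0 where
  lie_eq := by simp
  acts := by
    have : adOn K hK 0 = 0 := by ext; simp
    rw [this, map_zero]
    exact .of_zero

theorem add (h : ActsTriviallyOn ι ιU ρ φ K hK e u) (h' : ActsTriviallyOn ι ιU ρ φ K hK e' u') :
    ActsTriviallyOn ι ιU ρ φ K hK (e + e') (u + u') where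
  lie_eq := by simp [h.lie_eq, h'.lie_eq]
  acts := by
    have : adOn K hK (e + e') = adOn K hK e + adOn K hK e' := by ext; simp
    rw [this, map_add]
    exact h.acts.add h'.acts

theorem smul (c : F) (h : ActsTriviallyOn ι ιU ρ φ K hK e u) :
    ActsTriviallyOn ι ιU ρ φ K hK (c • e) (c • u) where
  lie_eq := by simp [h.lie_eq]
  acts := by
    have : adOn K hK (c • e) = c • adOn K hK e := by ext; simp
    rw [this, map_smul]
    exact h.acts.smul c

theorem exists_lie_eq [Fact p.Prime] (hU : IsPEnvelope F p pmU ιU) (v : U) (x : L) :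
    ∃ y, ⁅v, ιU x⁆ = ιU y := by
  obtain ⟨y, hy⟩ := (ιU.mem_range _).1 (hU.lie_mem v (ιU x))
  exact ⟨y, hy.symm⟩

theorem lie [Fact p.Prime] (hU : IsPEnvelope F p pmU ιU)
    (h : ActsTriviallyOn ι ιU ρ φ K hK e u) (h' : ActsTriviallyOn ι ιU ρ φ K hK e' u') :
    ActsTriviallyOn ι ιU ρ φ K hK ⁅e, e'⁆ ⁅u, u'⁆ where
  lie_eq x := by
    obtain ⟨y, hy⟩ := exists_lie_eq hU u x
    obtain ⟨y', hy'⟩ := exists_lie_eq hU u' x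
    rw [LieHom.map_lie, lie_lie, lie_lie, h.lie_eq, h'.lie_eq, hy, hy', h.lie_eq, h'.lie_eq]
  acts := by
    have : adOn K hK ⁅e, e'⁆ = ⁅adOn K hK e, adOn K hK e'⁆ := by
      ext; simp [LieRing.of_associative_ring_bracket]
    rw [this, LieHom.map_lie]
    exact h.acts.lie h'.acts

theorem pmap [Fact p.Prime] [CharP F p] (hE : IsPEnvelope F p pm ι) (hU : IsPEnvelope F p pmU ιU)
    (hφ : φ.comp ι = ιU) (hρ : IsRestrictedHom pmU (fun a => a ^ p) ρ)
    (h : ActsTriviallyOn ι ιU ρ φ K hK e u) :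
    ActsTriviallyOn ι ιU ρ φ K hK (pm e) (pmU u) where
  lie_eq x := by
    -- `φ` need not respect `p`-mappings, but it does intertwine powers of `ad e` and `ad u` on `L`:
    -- `ad u` preserves `ιU(L)`, where `u` and `φ e` agree.
    have key (n : ℕ) : φ (((LieAlgebra.ad F E e) ^ n) (ι x)) =
          ((LieAlgebra.ad F U u) ^ n) (ιU x) ∧
        ∃ y, ((LieAlgebra.ad F U u) ^ n) (ιU x) = ιU y := by
      induction n with
      | zero => exact ⟨LieHom.congr_fun hφ x, x, rfl⟩
      | succ n ih =>
        obtain ⟨h₁, y, hy⟩ := ih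
        rw [pow_succ', pow_succ', End.mul_apply, End.mul_apply, LieAlgebra.ad_apply,
          LieAlgebra.ad_apply, LieHom.map_lie, h₁, hy, h.lie_eq]
        exact ⟨rfl, exists_lie_eq hU u y⟩
    have hx : φ (ι x) = ιU x := LieHom.congr_fun hφ x
    rw [hU.isPMap.lie_pm, ← (key p).1, ← hE.isPMap.lie_pm, LieHom.map_lie, hx]
  acts := by
    have hpow (n : ℕ) (x : K) :
        (((adOn K hK e) ^ n) x : E) = ((LieAlgebra.ad F E e) ^ n) (x : E) := by
      induction n with
      | zero => rfl
      | succ n ih => rw [pow_succ', pow_succ', End.mul_apply, End.mul_apply, coe_adOn, ih]; rfl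
    have : adOn K hK (pm e) = (adOn K hK e) ^ p := by
      ext x
      rw [hpow, coe_adOn, hE.isPMap.lie_pm]
    rw [this, hρ]
    exact h.acts.pow p

theorem of_mem (hEM : LieModule.toEnd F E M = ρ.comp φ) (hφ : φ.comp ι = ιU)
    (hιK : ι.range ≤ K) (x : L) : ActsTriviallyOn ι ιU ρ φ K hK (ι x) (ιU x) where
  lie_eq y := by rw [← hφ]; rfl
  acts := by
    have h₁ : ρ (ιU x) = LieModule.toEnd F E M (ι x) := by rw [hEM, ← hφ]; rfl
    rw [h₁]
    exact ActsTrivially.ad_toEnd (⟨ι x, hιK ⟨x, rfl⟩⟩ : K)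

end ActsTriviallyOn

variable [Fact p.Prime] [CharP F p]

/-- A `p`-envelope of `L` acts trivially on the cohomology of its subalgebras containing `L`. -/
theorem IsPEnvelope.actsTrivially (hE : IsPEnvelope F p pm ι) (hU : IsPEnvelope F p pmU ιU)
    (hφ : φ.comp ι = ιU) (hρ : IsRestrictedHom pmU (fun a => a ^ p) ρ)
    (hEM : LieModule.toEnd F E M = ρ.comp φ) (K : LieSubalgebra F E)
    (hK : ∀ x y : E, ⁅x, y⁆ ∈ K) (hιK : ι.range ≤ K) (e : E) :
    ActsTrivially (adOn K hK e) (LieModule.toEnd F E M e) := by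
  have left (e : E) : ∃ u, ActsTriviallyOn ι ιU ρ φ K hK e u := by
    induction e using pSpan_induction hE.pSpan_eq_top with
    | mem x hx =>
      obtain ⟨x, rfl⟩ := hx
      exact ⟨_, .of_mem hEM hφ hιK x⟩
    | zero => exact ⟨_, .zero⟩
    | add a b ha hb => exact ⟨_, ha.choose_spec.add hb.choose_spec⟩
    | smul c a ha => exact ⟨_, ha.choose_spec.smul c⟩
    | lie a b ha hb => exact ⟨_, ha.choose_spec.lie hU hb.choose_spec⟩
    | pmap a ha => exact ⟨_, ha.choose_spec.pmap hE hU hφ hρ⟩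
  -- The pairing is symmetric in its closure properties, so generation of `U` gives a partner in `E`
  -- for each `u`.
  have right (u : U) : ∃ e, ActsTriviallyOn ι ιU ρ φ K hK e u := by
    induction u using pSpan_induction hU.pSpan_eq_top with
    | mem x hx =>
      obtain ⟨x, rfl⟩ := hx
      exact ⟨_, .of_mem hEM hφ hιK x⟩
    | zero => exact ⟨_, .zero⟩
    | add a b ha hb => exact ⟨_, ha.choose_spec.add hb.choose_spec⟩
    | smul c a ha => exact ⟨_, ha.choose_spec.smul c⟩
    | lie a b ha hb => exact ⟨_, ha.choose_spec.lie hU hb.choose_spec⟩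
    | pmap a ha => exact ⟨_, ha.choose_spec.pmap hE hU hφ hρ⟩
  obtain ⟨u, hu⟩ := left e
  -- `u - φ e` centralizes `ιU(L)`. Its partner `e'` then centralizes `ι(L)`, because `φ` is
  -- injective there, so `e'` is central in `E` and `ad e' = 0`.
  obtain ⟨e', he'⟩ := right (u - φ e)
  have hcentral (x : L) : ⁅ι x, e'⁆ = 0 := by
    obtain ⟨y, hy⟩ := (ι.mem_range _).1 (hE.lie_mem (ι x) e')
    have h₁ : φ ⁅e', ι x⁆ = 0 := by
      have hx : φ (ι x) = ιU x := LieHom.congr_fun hφ x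
      rw [LieHom.map_lie, hx, he'.lie_eq, sub_lie, hu.lie_eq, sub_self]
    have h₂ : ιU y = 0 := by
      rw [← hφ, LieHom.comp_apply, hy, ← lie_skew, map_neg, h₁, neg_zero]
    rw [← hy, (map_eq_zero_iff ιU hU.injective).1 h₂, map_zero]
  have h₀ : adOn K hK e' = 0 := by
    ext x
    rw [coe_adOn, ← lie_skew, hE.lie_eq_zero hcentral, neg_zero]
    rfl
  have := hu.acts.sub he'.acts
  rw [h₀, sub_zero, ← map_sub, sub_sub_cancel] at this
  rwa [hEM]

end RestrictedLie

theorem mainTheorem3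
    {F : Type*} [Field F] (p : ℕ) [Fact p.Prime] [CharP F p]
    -- a finite-dimensional Lie algebra `L` and a finite-dimensional `L`-module `M`
    {L : Type*} [LieRing L] [LieAlgebra F L] [FiniteDimensional F L]
    {M : Type*} [AddCommGroup M] [Module F M] [FiniteDimensional F M]
    [LieRingModule L M] [LieModule F L M]
    -- a `p`-envelope `E` of `L` with `dim E / L` finite
    {E : Type*} [LieRing E] [LieAlgebra F E] (pm : E → E) (ι : L →ₗ⁅F⁆ E)
    (hE : RestrictedLie.IsPEnvelope F p pm ι)
    [FiniteDimensional F (E ⧸ ι.range.toSubmodule)]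
    -- the universal `p`-envelope `U` of `L`, with the restricted extension `ρ` of the representation
    -- of `L` on `M`
    {U : Type*} [LieRing U] [LieAlgebra F U] (pmU : U → U) (ιU : L →ₗ⁅F⁆ U)
    (hU : RestrictedLie.IsUniversalPEnvelope F p pmU ιU)
    (ρ : U →ₗ⁅F⁆ Module.End F M)
    (hρ : RestrictedLie.IsRestrictedHom pmU (fun a => a ^ p) ρ)
    (hριU : ρ.comp ιU = LieModule.toEnd F L M)
    -- `M` as an `E`-module by means of a homomorphism `φ : E → U` over `L`
    (φ : E →ₗ⁅F⁆ U) (hφ : φ.comp ι = ιU)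
    [LieRingModule E M] [LieModule F E M]
    (hEM : LieModule.toEnd F E M = ρ.comp φ)
    (k : ℕ) (hk : k = Module.finrank F (E ⧸ ι.range.toSubmodule)) :
    Nonempty (LieCohomology.H0 F E M ≃ₗ[F] LieCohomology.H0 F L M) ∧
    Module.finrank F (LieCohomology.H1 F E M) =
      Module.finrank F (LieCohomology.H1 F L M)
        + k * Module.finrank F (LieModule.maxTrivSubmodule F L M) ∧
    Module.finrank F (LieCohomology.H2 F E M) =
      Module.finrank F (LieCohomology.H2 F L M)
        + k * Module.finrank F (LieCohomology.H1 F L M)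
        + k * (k - 1) / 2 * Module.finrank F (LieModule.maxTrivSubmodule F L M) := by
  have hUE := hU.toIsPEnvelope
  have hle := hE.lie_mem
  have hact (K : LieSubalgebra F E) (hK : ι.range ≤ K) (e : E) :=
    hE.actsTrivially hUE hφ hρ hEM K (fun x y => hK (hle x y)) hK e
  have : FiniteDimensional F ι.range.toSubmodule :=
    inferInstanceAs (FiniteDimensional F (LinearMap.range (ι : L →ₗ[F] E)))
  have : FiniteDimensional F E :=
    Module.Finite.of_submodule_quotient ι.range.toSubmodule
  have hdim := LieCohomology.cocycleDims_top (M := M) hle hact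
  rw [← hk] at hdim
  let j₁ : (⊤ : LieSubalgebra F E) ≃ₗ⁅F⁆ E := LieSubalgebra.topEquiv
  let j₂ : L ≃ₗ⁅F⁆ ι.range := LieEquiv.ofInjective ι hE.injective
  have hj₁ (a : (⊤ : LieSubalgebra F E)) (m : M) : ⁅j₁ a, m⁆ = ⁅a, m⁆ := rfl
  have hj₂ (a : L) (m : M) : ⁅j₂ a, m⁆ = ⁅a, m⁆ := by
    change LieModule.toEnd F E M (ι a) m = LieModule.toEnd F L M a m
    rw [hEM, ← hριU, ← hφ]
    rfl
  have z0 : Module.finrank F (LinearMap.ker (LieCohomology.d₀₁ F E M)) =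
      Module.finrank F (LinearMap.ker (LieCohomology.d₀₁ F L M)) := by
    rw [LieCohomology.ker_d₀₁_eq_of_equiv j₁ hj₁, hdim.zero,
      LieCohomology.ker_d₀₁_eq_of_equiv j₂ hj₂]
  have z1 := hdim.one
  have z2 := hdim.two
  have dE := hdim.dim
  rw [← LieCohomology.finrank_Z1_eq_of_equiv j₁ hj₁, LieCohomology.finrank_Z1_eq_of_equiv j₂ hj₂,
    LieCohomology.ker_d₀₁_eq_of_equiv j₂ hj₂] at z1
  rw [← LieCohomology.finrank_twoCocycle_eq_of_equiv j₁ hj₁,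
    LieCohomology.finrank_twoCocycle_eq_of_equiv j₂ hj₂,
    LieCohomology.finrank_Z1_eq_of_equiv j₂ hj₂, LieCohomology.ker_d₀₁_eq_of_equiv j₂ hj₂] at z2
  rw [← j₂.toLinearEquiv.finrank_eq, j₁.toLinearEquiv.finrank_eq] at dE
  have hM : Module.finrank F (LieModule.maxTrivSubmodule F L M) =
      Module.finrank F (LinearMap.ker (LieCohomology.d₀₁ F L M)) := by
    have : (LieModule.maxTrivSubmodule F L M).toSubmodule =
        LinearMap.ker (LieCohomology.d₀₁ F L M) := by
      ext m
      exact (LieModule.mem_maxTrivSubmodule F L M m).trans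
        (LinearMap.ext_iff (f := LieCohomology.d₀₁ F L M m) (g := 0)).symm
    exact congrArg (fun N : Submodule F M => Module.finrank F N) this
  have e1 := LieCohomology.finrank_H1_add F E M
  have l1 := LieCohomology.finrank_H1_add F L M
  have e2 := LieCohomology.finrank_H2_add F E M
  have l2 := LieCohomology.finrank_H2_add F L M
  rw [hM, ← Nat.choose_two_right]
  -- The invariants of `E` and of `L` have equal dimension, so `dim H¹` grows exactly as `dim Z¹`
  -- does.
  have h1 : Module.finrank F (LieCohomology.H1 F E M) = Module.finrank F (LieCohomology.H1 F L M)
      + k * Module.finrank F (LinearMap.ker (LieCohomology.d₀₁ F L M)) := by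
    linarith
  refine ⟨FiniteDimensional.nonempty_linearEquiv_of_finrank_eq z0, h1, ?_⟩
  rw [dE] at e2
  -- The 1-cochains grow by `k * dim M`; `k` times the relation `l1` turns `k * dim Z¹(L)` into `k *
  -- dim H¹(L)`.
  nlinarith
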